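/- **Setting.** Let $q(x_1,\dots,x_k)\;{:}{-}\;S_1(\mathbf y_1),\dots,S_l(\mathbf y_l)$ be a full conjunctive query without self-joins: atom $S_j$ has arity $r_j\ge 1$, $\mathbf y_j$ is a vector of $r_j$ distinct variables, and every $x_i$ occurs in some atom. A *fractional edge packing* of $q$ is a vector $\mathbf u=(u_1,\dots,u_l)$ with $u_j\ge 0$ and $\sum_{j:\,x_i\in S_j}u_j\le 1$ for every variable $x_i$; put $u=\sum_j u_j$. A *database* over $[n]$ assigns to each atom $S_j$ a relation $S_j\subseteq[n]^{r_j}$. *Input distributions.* Let $\theta\in(0,1)$. (i) $\mathcal I$ is the uniform distribution on matching databases with $m$ tuples per relation over $[n]$, that is, databases with $|S_j|=m$ for all $j$ in which, for every relation, attribute and value $v\in[n]$, at most one tuple has value $v$ in that attribute; here $m\le n$, and $m\le\theta n$ if some atom has arity $1$. (ii) $\mathcal I^d$ is the uniform distribution on $\theta$-dense databases over $[n]$ with equal cardinalities $m$, that is, databases with $|S_j|=m=\theta n^{r_j}$ for all $j$. *Algorithms.* A one-round algorithm uses $p\ge 1$ machines. Each relation is initially stored at a separate location; machine $c$ receives from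 each $S_j$ a bit string that is a function of $S_j$, and then outputs a set of tuples computed from the strings it received. The output is the union over all machines, and on every instance in the support of the distribution it may contain only tuples of $q(I)$. Machine $c$ has a cost function $g_c:\mathbb Z_{\ge0}\to\mathbb R_{\ge0}$, and the load is the maximum of $g_c(N_c)$ over all machines $c$ and all instances in the support, where $N_c$ is the number of bits received by $c$. *Cost functions.* $g$ is *well-behaved with exponent $a>1$* if $g(0)=0$, $g$ is increasing, and $g((1+\delta)x)\le(1+\delta)^a g(x)$ for all integers $x\ge1$ and real $\delta\ge0$ with $(1+\delta)x$ an integer. Put $g^*(L)=\max\{x: g(x)\le L\}$ ($=\infty$ if there are arbitrarily large such $x$), and let $\bar L_{\mathbf u}$ be the minimum $L\ge0$ such that $$\sum_{c=1}^p g_c^*(L)^u\ \ge\ m^u .$$ **Theorem.** Let $q$, $\theta\in(0,1)$ and $a>1$ be given. 1. There is a constant $C>0$, depending only on $q,\theta,a$, such that for all $n\ge2$, $m$, $p\ge1$, all cost functions $g_1,\dots,g_p$ that are well-behaved with exponent $a$, and all fractional edge packings $\mathbf u$ of $q$: every one-round algorithm that for $I\sim\mathcal I$ outputs in expectation at least $E_{I\sim\mathcal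 I}[|q(I)|]$ tuples has load at least $C\,\bar L_{\mathbf u}$. The same holds for $\mathcal I^d$ in place of $\mathcal I$. 2. The minimum defining $\bar L_{\mathbf u}$ is attained, and if $\mathbf u^*$ is a fractional edge packing of maximum total weight, then $\bar L_{\mathbf u^*}=\max_{\mathbf u}\bar L_{\mathbf u}$, the maximum being over all fractional edge packings $\mathbf u$ of $q$. -/

import Mathlib

open scoped NNReal ENNReal BigOperators

/-- A full conjunctive query `q(x_1,…,x_k) :- S_1(y_1),…,S_l(y_l)` without self-joins.
Atom `j` has its own relation symbol, positive arity `arity j`, and is applied to the pairwise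
distinct variables `vars j 0, vars j 1, …`; every variable of the head occurs in some atom. -/
structure FullCQ where
  /-- number of variables -/
  k : ℕ
  /-- number of atoms -/
  l : ℕ
  arity : Fin l → ℕ
  arity_pos : ∀ j, 0 < arity j
  vars : (j : Fin l) → Fin (arity j) ↪ Fin k
  safe : ∀ i : Fin k, ∃ j, i ∈ Set.range (vars j)

/-- A relation of arity `r` over the domain `[n]`: a finite set of tuples. -/
abbrev DBRel (n r : ℕ) : Type := Finset (Fin r → Fin n)

namespace FullCQ

/-- A database instance for `q` over the domain `[n]`. -/
abbrev Instance (q : FullCQ) (n : ℕ) : Type := (j : Fin q.l) → DBRel n (q.arity j)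

/-- The answer `q(I)`. -/
def eval (q : FullCQ) {n : ℕ} (I : q.Instance n) : Finset (Fin q.k → Fin n) :=
  Finset.univ.filter fun x => ∀ j, (fun i => x (q.vars j i)) ∈ I j

/-- Fractional edge packings of `q`. -/
def IsEdgePacking (q : FullCQ) (u : Fin q.l → ℝ) : Prop :=
  (∀ j, 0 ≤ u j) ∧
    ∀ i : Fin q.k, ∑ j with i ∈ Set.range (q.vars j), u j ≤ 1

/-- Fractional edge packings of `q` of maximum total weight. -/
def IsMaxEdgePacking (q : FullCQ) (u : Fin q.l → ℝ) : Prop :=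
  q.IsEdgePacking u ∧ ∀ u', q.IsEdgePacking u' → ∑ j, u' j ≤ ∑ j, u j

end FullCQ

/-- The relations with exactly `m` tuples in which, for each attribute, every value occurs in at
most one tuple. -/
def matchingRels (n r m : ℕ) : Finset (DBRel n r) :=
  Finset.univ.filter fun S =>
    S.card = m ∧ ∀ i : Fin r, ∀ a ∈ S, ∀ b ∈ S, a i = b i → a = b

/-- The relations with exactly `m` tuples. -/
def sizeRels (n r m : ℕ) : Finset (DBRel n r) :=
  Finset.univ.filter fun S => S.card = m

namespace FullCQ

/-- The matching databases with `m` tuples per relation over `[n]`. -/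
def matchingDBs (q : FullCQ) (n m : ℕ) : Finset (q.Instance n) :=
  Fintype.piFinset fun j => matchingRels n (q.arity j) m

/-- The databases with `m` tuples per relation over `[n]`; these are the `θ`-dense databases when
`m = θ * n ^ r_j` for every atom `j`. -/
def denseDBs (q : FullCQ) (n m : ℕ) : Finset (q.Instance n) :=
  Fintype.piFinset fun j => sizeRels n (q.arity j) m

end FullCQ

/-- A one-round algorithm on `p` machines. Each relation is initially stored at a separate
location, so the bit string that machine `c` receives from `S_j` is a function of `S_j`. Afterwards
machine `c` outputs a set of tuples computed from all the bit strings that it received. -/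
structure OneRoundAlgorithm (q : FullCQ) (n p : ℕ) where
  msg : Fin p → (j : Fin q.l) → DBRel n (q.arity j) → List Bool
  out : Fin p → (Fin q.l → List Bool) → Finset (Fin q.k → Fin n)

namespace OneRoundAlgorithm

variable {q : FullCQ} {n p : ℕ}

/-- The number of bits received by machine `c` on the instance `I`. -/
def bits (A : OneRoundAlgorithm q n p) (c : Fin p) (I : q.Instance n) : ℕ :=
  ∑ j, (A.msg c j (I j)).length

/-- The output of the algorithm: the union of the outputs of the machines. -/
def output (A : OneRoundAlgorithm q n p) (I : q.Instance n) : Finset (Fin q.k → Fin n) :=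
  Finset.univ.biUnion fun c => A.out c fun j => A.msg c j (I j)

/-- On the instances in `D` the algorithm outputs only correct tuples. -/
def IsSound (A : OneRoundAlgorithm q n p) (D : Finset (q.Instance n)) : Prop :=
  ∀ I ∈ D, A.output I ⊆ q.eval I

/-- For `I` uniform in `D`, the algorithm outputs in expectation at least `E[|q(I)|]` tuples. -/
def OutputsEnough (A : OneRoundAlgorithm q n p) (D : Finset (q.Instance n)) : Prop :=
  Finset.expect D (fun I => ((q.eval I).card : ℝ)) ≤
    Finset.expect D (fun I => ((A.output I).card : ℝ))

/-- The load over the instances in `D`: the maximum of `g_c(N_c)` over all machines `c` and all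
instances, `N_c` being the number of bits that `c` receives. -/
def load (A : OneRoundAlgorithm q n p) (g : Fin p → ℕ → ℝ≥0) (D : Finset (q.Instance n)) : ℝ≥0 :=
  D.sup fun I => Finset.univ.sup fun c => g c (A.bits c I)

end OneRoundAlgorithm

/-- Well-behaved cost functions, with growth exponent `a`. -/
structure IsWellBehaved (a : ℝ) (g : ℕ → ℝ≥0) : Prop where
  map_zero : g 0 = 0
  mono : Monotone g
  growth : ∀ (x y : ℕ) (δ : ℝ), 1 ≤ x → 0 ≤ δ → (y : ℝ) = (1 + δ) * x →
    (g y : ℝ) ≤ (1 + δ) ^ a * g x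

/-- `g*(L)`, the largest `x` with `g x ≤ L`; it is `⊤` if there are arbitrarily large such `x`. -/
noncomputable def gStar (g : ℕ → ℝ≥0) (L : ℝ≥0) : ℕ∞ :=
  ⨆ (x : ℕ) (_ : g x ≤ L), (x : ℕ∞)

/-- The loads `L ≥ 0` with `∑_c g_c*(L) ^ u ≥ m ^ u`. -/
def feasibleLoads {p : ℕ} (g : Fin p → ℕ → ℝ≥0) (m : ℕ) (u : ℝ) : Set ℝ≥0 :=
  {L | (m : ℝ≥0∞) ^ u ≤ ∑ c, (gStar (g c) L : ℝ≥0∞) ^ u}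

/-- The least load in `feasibleLoads g m u`. -/
noncomputable def lowerLoad {p : ℕ} (g : Fin p → ℕ → ℝ≥0) (m : ℕ) (u : ℝ) : ℝ≥0 :=
  sInf (feasibleLoads g m u)

/-! ### Random relations -/

/-! A machine can only output an answer all of whose projections it is certain of. The support is a
product, so any `S_j` may be exchanged for another relation of its class with the same message
without changing what the machine sees. By soundness, every output tuple then projects into
`knownTuples` for each atom (`IsSound.mem_knownTuples`).

A short message certifies few tuples. In a spread class, `k` known tuples confine `S` to a fraction
`β ^ k` of the class, while `N` bits allow at most `4 ^ N` messages; hence the expected number of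
known tuples is at most `Λ * N` (`sum_card_knownTuples_le`).

Let `f_j(t)` be the probability that `t` is known divided by the probability that `t ∈ S_j`. By
rename invariance the denominator is `m / n ^ r_j` for every `t`, so `f_j` has average at most `Λ *
X_c / m` for a machine receiving at most `X_c` bits. The atoms are independent, so the fraction of
the expected answers found by machine `c` is at most the average of `∏ j, f_j` over all assignments.
The Hölder inequality for edge packings (`FullCQ.sum_prod_le`) bounds it by `(Λ * X_c / m) ^ u`.
Summing over machines gives `m ^ u ≤ ∑ c, (Λ * X_c) ^ u` (`rpow_le_sum_rpow`), and the growth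
condition turns the factor `Λ` into a factor `Λ ^ a` on the load.

For the second half, `gStar` is locally constant to the right in `L`, so the infimum is attained,
and feasible loads only become fewer as the exponent grows. -/

/-- Rename the values of a relation by one permutation of the domain for each attribute. -/
def renameRel {n r : ℕ} (σ : Fin r → Equiv.Perm (Fin n)) (S : DBRel n r) : DBRel n r :=
  S.map (Equiv.piCongrRight σ).toEmbedding

/-- A class of relations that is closed under attributewise renaming of values. -/
def IsRenameInvariant {n r : ℕ} (D : Finset (DBRel n r)) : Prop :=
  ∀ σ, ∀ S ∈ D, renameRel σ S ∈ D

/-- A class of relations such that the relations containing a set `A` of tuples are an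
exponentially small fraction, in the size of `A`, of the class. -/
def IsSpread {n r : ℕ} (β : ℝ) (D : Finset (DBRel n r)) : Prop :=
  ∀ A : DBRel n r, ((D.filter fun S => A ⊆ S).card : ℝ) ≤ β ^ A.card * D.card

/-- The tuples that are known to belong to `S`, given the message sent about `S`. -/
def knownTuples {n r : ℕ} (D : Finset (DBRel n r)) (msg : DBRel n r → List Bool)
    (S : DBRel n r) : DBRel n r :=
  Finset.univ.filter fun t => ∀ S' ∈ D, msg S' = msg S → t ∈ S'

lemma mem_renameRel {n r : ℕ} (σ : Fin r → Equiv.Perm (Fin n)) (S : DBRel n r)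
    (t : Fin r → Fin n) : t ∈ renameRel σ S ↔ (fun i => (σ i).symm (t i)) ∈ S := by
  simp only [renameRel, Finset.mem_map_equiv]
  rfl

lemma renameRel_injective {n r : ℕ} (σ : Fin r → Equiv.Perm (Fin n)) :
    Function.Injective (renameRel σ) :=
  Finset.map_injective _

lemma card_filter_mem_le {n r : ℕ} {D : Finset (DBRel n r)} (hD : IsRenameInvariant D)
    (t t' : Fin r → Fin n) :
    (D.filter fun S => t ∈ S).card ≤ (D.filter fun S => t' ∈ S).card := by
  refine Finset.card_le_card_of_injOn (renameRel fun i => Equiv.swap (t i) (t' i)) ?_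
    (renameRel_injective _).injOn
  intro S hS
  simp only [Finset.coe_filter, Set.mem_ofPred_eq] at hS ⊢
  refine ⟨hD _ _ hS.1, ?_⟩
  rw [mem_renameRel]
  simpa using hS.2

/-- A tuple belongs to a random relation of a rename invariant class with probability `m / n ^ r`. -/
lemma card_filter_mem {n r m : ℕ} {D : Finset (DBRel n r)} (hD : IsRenameInvariant D)
    (hm : ∀ S ∈ D, S.card = m) (t : Fin r → Fin n) :
    (D.filter fun S => t ∈ S).card * n ^ r = m * D.card := by
  have h1 : ∑ t' : Fin r → Fin n, (D.filter fun S => t' ∈ S).card = m * D.card := by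
    have := Finset.sum_card_bipartiteAbove_eq_sum_card_bipartiteBelow
      (s := (Finset.univ : Finset (Fin r → Fin n))) (t := D) (fun t' S => t' ∈ S)
    simp only [Finset.bipartiteAbove, Finset.bipartiteBelow] at this
    rw [this, Finset.sum_congr rfl (g := fun _ => m)]
    · simp [mul_comm]
    · intro S hS
      rw [← hm S hS]
      congr 1
      ext; simp
  rw [← h1, Finset.sum_congr rfl (g := fun _ => (D.filter fun S => t ∈ S).card)]
  · simp [mul_comm]
  · intro t' _
    exact le_antisymm (card_filter_mem_le hD _ _) (card_filter_mem_le hD _ _)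

lemma isRenameInvariant_sizeRels (n r m : ℕ) : IsRenameInvariant (sizeRels n r m) := by
  intro σ S hS
  simpa [sizeRels, renameRel] using hS

lemma isRenameInvariant_matchingRels (n r m : ℕ) : IsRenameInvariant (matchingRels n r m) := by
  intro σ S hS
  simp only [matchingRels, Finset.mem_filter, Finset.mem_univ, true_and] at hS ⊢
  refine ⟨by simpa [renameRel] using hS.1, fun i a ha b hb hab => ?_⟩
  rw [mem_renameRel] at ha hb
  have := hS.2 i _ ha _ hb (by simp [hab])
  funext i
  simpa using congrFun this i

/-! ### Tuples revealed by a short message -/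

lemma card_listBool_le (s : Finset (List Bool)) (N : ℕ) (hs : ∀ w ∈ s, w.length ≤ N) :
    s.card ≤ 4 ^ N := by
  classical
  have hsub : s ⊆ (Finset.range (N + 1)).biUnion fun i =>
      (Finset.univ : Finset (Fin i → Bool)).image List.ofFn := by
    intro w hw
    simp only [Finset.mem_biUnion, Finset.mem_range, Finset.mem_image, Finset.mem_univ, true_and]
    exact ⟨w.length, Nat.lt_succ_of_le (hs w hw), w.get, List.ofFn_get w⟩
  -- Base 4 absorbs the sum over all lengths without an additive term, so zero bits reveal nothing
  -- and the final bound stays proportional to `N`.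
  have h2 : ∀ N : ℕ, ∑ i ∈ Finset.range (N + 1), 2 ^ i ≤ 4 ^ N := by
    intro N
    induction N with
    | zero => simp
    | succ N ih =>
      rw [Finset.sum_range_succ]
      have : 2 ^ N ≤ 4 ^ N := Nat.pow_le_pow_left (by norm_num) N
      rw [pow_succ 2, pow_succ 4]
      omega
  calc s.card ≤ _ := Finset.card_le_card hsub
    _ ≤ ∑ i ∈ Finset.range (N + 1), 2 ^ i := by
      refine Finset.card_biUnion_le.trans (Finset.sum_le_sum fun i _ => ?_)
      exact Finset.card_image_le.trans (by simp)
    _ ≤ 4 ^ N := h2 N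

/-- A message of `N` bits about a random relation of a spread class reveals `O(N)` tuples in
expectation. -/
lemma sum_card_knownTuples_le {n r N : ℕ} {β : ℝ} (hβ₀ : 0 < β) (hβ₁ : β < 1)
    {D : Finset (DBRel n r)} (hD : IsSpread β D) (msg : DBRel n r → List Bool)
    (hN : ∀ S ∈ D, (msg S).length ≤ N) :
    ∑ S ∈ D, ((knownTuples D msg S).card : ℝ) ≤ Real.log 4 / Real.log β⁻¹ * N * D.card := by
  classical
  have hlog : 0 < Real.log β⁻¹ := Real.log_pos ((one_lt_inv₀ hβ₀).2 hβ₁)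
  set b : ℝ := β⁻¹ with hb
  have hb0 : 0 < b := inv_pos.2 hβ₀
  set M : ℝ := 4 ^ N with hM
  have hM0 : 0 < M := by positivity
  -- The known set is constant on each message class, and that class lies among the relations
  -- containing it. Spreadness thus bounds each class's contribution by `D.card`, and there are at
  -- most `M` classes.
  have hexp : ∑ S ∈ D, b ^ (knownTuples D msg S).card ≤ M * D.card := by
    rw [← Finset.sum_fiberwise_of_maps_to (s := D) (t := D.image msg) (g := msg)
      fun S hS => Finset.mem_image_of_mem _ hS]
    calc _ ≤ ∑ w ∈ D.image msg, (D.card : ℝ) := by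
          refine Finset.sum_le_sum fun w hw => ?_
          obtain ⟨S₀, hS₀, rfl⟩ := Finset.mem_image.1 hw
          have hk : ∀ S ∈ D.filter (fun S => msg S = msg S₀),
              b ^ (knownTuples D msg S).card = b ^ (knownTuples D msg S₀).card := by
            intro S hS
            have : knownTuples D msg S = knownTuples D msg S₀ := by
              simp only [knownTuples, (Finset.mem_filter.1 hS).2]
            rw [this]
          rw [Finset.sum_congr rfl hk, Finset.sum_const, nsmul_eq_mul]
          have hsub : D.filter (fun S => msg S = msg S₀) ⊆
              D.filter (fun S => knownTuples D msg S₀ ⊆ S) := by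
            intro S hS
            rw [Finset.mem_filter] at hS ⊢
            exact ⟨hS.1, fun t ht => (Finset.mem_filter.1 ht).2 S hS.1 hS.2⟩
          calc _ ≤ (β ^ (knownTuples D msg S₀).card * D.card) *
                b ^ (knownTuples D msg S₀).card := by
                gcongr
                exact (Nat.cast_le.2 (Finset.card_le_card hsub)).trans (hD _)
            _ = D.card := by
                rw [mul_right_comm, ← mul_pow, hb, mul_inv_cancel₀ hβ₀.ne', one_pow, one_mul]
      _ = ((D.image msg).card : ℝ) * D.card := by simp
      _ ≤ M * D.card := by
          gcongr
          have := card_listBool_le (D.image msg) N (by simpa using hN)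
          rw [hM]
          exact_mod_cast this
  -- Jensen's inequality by hand: the tangent of `exp` at `log M`, evaluated at `k * log b`.
  have htan : ∀ k : ℕ, M * (1 + k * Real.log b - N * Real.log 4) ≤ b ^ k := by
    intro k
    have h := Real.add_one_le_exp (Real.log (b ^ k / M))
    rw [Real.exp_log (by positivity), le_div_iff₀ hM0, Real.log_div (by positivity) hM0.ne', hM,
      Real.log_pow, Real.log_pow] at h
    linarith
  have h3 : ∑ S ∈ D, M * (1 + ((knownTuples D msg S).card : ℝ) * Real.log b - N * Real.log 4) ≤
      M * D.card := (Finset.sum_le_sum fun S _ => htan _).trans hexp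
  rw [← Finset.mul_sum] at h3
  have h4 := le_of_mul_le_mul_left h3 hM0
  rw [Finset.sum_sub_distrib, Finset.sum_add_distrib, ← Finset.sum_mul] at h4
  simp only [Finset.sum_const, nsmul_eq_mul, mul_one] at h4
  rw [div_mul_eq_mul_div, div_mul_eq_mul_div, le_div_iff₀ hlog]
  linarith

/-! ### Spreadness of the two input classes -/

lemma card_filter_sizeRels_superset {n r m : ℕ} (A : DBRel n r) (hA : A.card ≤ m) :
    ((sizeRels n r m).filter fun S => A ⊆ S).card = (n ^ r - A.card).choose (m - A.card) := by
  classical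
  have h : (Finset.univ \ A).card = n ^ r - A.card := by
    rw [Finset.card_sdiff_of_subset (Finset.subset_univ A)]; simp
  rw [← h, ← Finset.card_powersetCard]
  refine Finset.card_nbij' (fun S => S \ A) (fun T => T ∪ A) ?_ ?_ ?_ ?_
  · intro S hS
    simp only [sizeRels, Finset.coe_filter, Finset.mem_filter, Finset.mem_univ, true_and,
      Set.mem_ofPred_eq] at hS
    simp only [Finset.mem_coe, Finset.mem_powersetCard]
    refine ⟨Finset.sdiff_subset_sdiff (Finset.subset_univ _) le_rfl, ?_⟩
    rw [Finset.card_sdiff_of_subset hS.2, hS.1]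
  · intro T hT
    simp only [Finset.mem_coe, Finset.mem_powersetCard] at hT
    simp only [sizeRels, Finset.coe_filter, Finset.mem_filter, Finset.mem_univ, true_and,
      Set.mem_ofPred_eq]
    refine ⟨?_, Finset.subset_union_right⟩
    rw [Finset.card_union_of_disjoint, hT.2]
    · omega
    · exact Finset.disjoint_of_subset_left hT.1 Finset.sdiff_disjoint
  · intro S hS
    simp only [Finset.coe_filter, Set.mem_ofPred_eq] at hS
    exact Finset.sdiff_union_of_subset hS.2
  · intro T hT
    simp only [Finset.mem_coe, Finset.mem_powersetCard] at hT
    exact Finset.union_sdiff_cancel_right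
      (Finset.disjoint_of_subset_left hT.1 Finset.sdiff_disjoint)

/-- Each step multiplies by `(m - k) / (N - k)`, which stays at most `θ` because `m ≤ θ * N` and `θ
≤ 1`. -/
lemma choose_sub_le {N m : ℕ} {θ : ℝ} (hθ : θ ≤ 1) (hm : (m : ℝ) ≤ θ * N) (hmN : m ≤ N) (k : ℕ)
    (hk : k ≤ m) : ((N - k).choose (m - k) : ℝ) ≤ θ ^ k * N.choose m := by
  induction k with
  | zero => simp
  | succ k ih =>
    specialize ih (by omega)
    obtain ⟨a, ha⟩ : ∃ a, N - k = a + 1 := ⟨N - k - 1, by omega⟩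
    obtain ⟨b, hb⟩ : ∃ b, m - k = b + 1 := ⟨m - k - 1, by omega⟩
    have hab := Nat.add_one_mul_choose_eq a b
    rw [show N - (k + 1) = a by omega, show m - (k + 1) = b by omega]
    rw [ha, hb] at ih
    have hab' : ((a : ℝ) + 1) * a.choose b = (a + 1).choose (b + 1) * (b + 1) := by
      exact_mod_cast hab
    have hba : (b : ℝ) + 1 ≤ θ * (a + 1) := by
      have e1 : (N : ℝ) = a + 1 + k := by exact_mod_cast (by omega : N = a + 1 + k)
      have e2 : (m : ℝ) = b + 1 + k := by exact_mod_cast (by omega : m = b + 1 + k)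
      have : θ * k ≤ k := mul_le_of_le_one_left (by positivity) hθ
      rw [e1, e2] at hm
      linarith
    have hθ0 : 0 ≤ θ := by
      by_contra hneg
      have : θ * ((a : ℝ) + 1) ≤ 0 := mul_nonpos_of_nonpos_of_nonneg (by linarith) (by positivity)
      have : (0 : ℝ) ≤ b := by positivity
      linarith
    have hpos : (0 : ℝ) < a + 1 := by positivity
    refine le_of_mul_le_mul_left ?_ hpos
    rw [hab']
    calc ((a + 1).choose (b + 1) : ℝ) * (b + 1)
        ≤ (θ ^ k * N.choose m) * (θ * (a + 1)) := by gcongr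
      _ = _ := by ring

lemma isSpread_sizeRels {n r m : ℕ} {θ : ℝ} (hθ₀ : 0 ≤ θ) (hθ : θ ≤ 1)
    (hm : (m : ℝ) ≤ θ * (n : ℝ) ^ r) : IsSpread θ (sizeRels n r m) := by
  classical
  intro A
  have hmN : m ≤ n ^ r := by
    have : (m : ℝ) ≤ (n : ℝ) ^ r := hm.trans (mul_le_of_le_one_left (by positivity) hθ)
    exact_mod_cast this
  by_cases hA : A.card ≤ m
  · rw [card_filter_sizeRels_superset A hA]
    have h0 := card_filter_sizeRels_superset (n := n) (r := r) (m := m) ∅ (by simp)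
    simp only [Finset.empty_subset, Finset.filter_true, Finset.card_empty, Nat.sub_zero] at h0
    rw [h0]
    exact choose_sub_le hθ (by exact_mod_cast hm) hmN _ hA
  · have : (sizeRels n r m).filter (fun S => A ⊆ S) = ∅ := by
      refine Finset.filter_eq_empty_iff.2 fun S hS hAS => hA ?_
      have := Finset.card_le_card hAS
      simp only [sizeRels, Finset.mem_filter, Finset.mem_univ, true_and] at hS
      omega
    rw [this]
    simp only [Finset.card_empty, Nat.cast_zero]
    positivity

/-- A unary matching is just a set of values. It could be all of `[n]`, which is why unary atoms
need `m ≤ θ * n`. -/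
lemma matchingRels_one (n m : ℕ) : matchingRels n 1 m = sizeRels n 1 m := by
  ext S
  simp only [matchingRels, sizeRels, Finset.mem_filter, Finset.mem_univ, true_and,
    and_iff_left_iff_imp]
  intro _ i a _ b _ hab
  funext i'
  rwa [Subsingleton.elim i' i]

/-- Swapping `t i₀` with a value `v` unused by `t` and `A` in attribute `i₀` injects the matchings
containing `t` and `A` into those containing `A` but not `t`. -/
lemma matchingRels_superset_step {n r m : ℕ} (hr : 2 ≤ r) (A : DBRel n r) (t : Fin r → Fin n)
    (ht : t ∉ A) (hA : A.card + 2 ≤ n) :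
    2 * ((matchingRels n r m).filter fun S => insert t A ⊆ S).card ≤
      ((matchingRels n r m).filter fun S => A ⊆ S).card := by
  classical
  let i₀ : Fin r := ⟨0, by omega⟩
  let i₁ : Fin r := ⟨1, by omega⟩
  have hi : i₁ ≠ i₀ := by simp [i₀, i₁]
  obtain ⟨v, hv⟩ : ∃ v : Fin n, v ∉ (insert t A).image (fun s => s i₀) := by
    by_contra! h
    have h1 : (Finset.univ : Finset (Fin n)) ⊆ (insert t A).image (fun s => s i₀) :=
      fun v _ => h v
    have h2 := Finset.card_le_card h1
    have h3 := h2.trans Finset.card_image_le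
    rw [Finset.card_insert_of_notMem ht] at h3
    simp at h3
    omega
  simp only [Finset.mem_image, Finset.mem_insert, not_exists, not_and] at hv
  let σ : Fin r → Equiv.Perm (Fin n) := fun i => if i = i₀ then Equiv.swap (t i₀) v else Equiv.refl _
  have hmap : ((matchingRels n r m).filter fun S => insert t A ⊆ S).card ≤
      ((matchingRels n r m).filter fun S => A ⊆ S ∧ t ∉ S).card := by
    refine Finset.card_le_card_of_injOn (renameRel σ) ?_ (renameRel_injective _).injOn
    intro S hS
    simp only [Finset.coe_filter, Set.mem_ofPred_eq] at hS ⊢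
    obtain ⟨hSm, hAS⟩ := hS
    have htS : t ∈ S := hAS (Finset.mem_insert_self _ _)
    have hmat : ∀ i : Fin r, ∀ a ∈ S, ∀ b ∈ S, a i = b i → a = b := (Finset.mem_filter.1 hSm).2.2
    refine ⟨isRenameInvariant_matchingRels _ _ _ _ _ hSm, fun s hs => ?_, fun htS' => ?_⟩
    · rw [mem_renameRel]
      have hsS : s ∈ S := hAS (Finset.mem_insert_of_mem hs)
      convert hsS using 1
      funext i
      by_cases h : i = i₀
      · subst h
        have e1 : s i₀ ≠ t i₀ := fun h => ht (hmat _ _ hsS _ htS h ▸ hs)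
        have e2 : s i₀ ≠ v := hv s (Or.inr hs)
        simp [σ, Equiv.swap_apply_of_ne_of_ne e1 e2]
      · simp [σ, h]
    · rw [mem_renameRel] at htS'
      -- The second attribute is untouched by `σ`, so the preimage of `t` would agree with `t` there
      -- and hence equal `t`. This is where arity at least 2 enters.
      have h1 := hmat i₁ _ htS' _ htS (by simp [σ, hi])
      have h2 := congrFun h1 i₀
      simp only [σ, if_true, Equiv.symm_swap, Equiv.swap_apply_left] at h2
      exact hv t (Or.inl rfl) h2.symm
  have hsplit : ((matchingRels n r m).filter fun S => insert t A ⊆ S).card +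
      ((matchingRels n r m).filter fun S => A ⊆ S ∧ t ∉ S).card =
      ((matchingRels n r m).filter fun S => A ⊆ S).card := by
    rw [← Finset.card_filter_add_card_filter_not (s := (matchingRels n r m).filter fun S => A ⊆ S)
      (fun S => t ∈ S), Finset.filter_filter, Finset.filter_filter]
    congr 2
    ext S
    simp only [Finset.mem_filter, Finset.insert_subset_iff]
    tauto
  omega

lemma matchingRels_superset_le {n r m : ℕ} (hr : 2 ≤ r) (A : DBRel n r) (hA : A.card + 1 ≤ n) :
    2 ^ A.card * ((matchingRels n r m).filter fun S => A ⊆ S).card ≤ (matchingRels n r m).card := by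
  classical
  induction A using Finset.induction_on with
  | empty => simp
  | insert t A ht ih =>
    rw [Finset.card_insert_of_notMem ht] at hA ⊢
    have h1 := matchingRels_superset_step (m := m) hr A t ht (by omega)
    have h2 := ih (by omega)
    calc _ = 2 ^ A.card * (2 * ((matchingRels n r m).filter fun S => insert t A ⊆ S).card) := by
          ring
      _ ≤ _ := (Nat.mul_le_mul_left _ h1).trans h2

lemma isSpread_matchingRels {n r m : ℕ} (hr : 2 ≤ r) (hn : 2 ≤ n) (hmn : m ≤ n) :
    IsSpread (√2)⁻¹ (matchingRels n r m) := by
  classical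
  intro A
  set f : ℕ := ((matchingRels n r m).filter fun S => A ⊆ S).card with hf
  -- The rate `(√2)⁻¹` instead of `1 / 2` leaves room for the case `A.card = n`, where no fresh
  -- value exists: dropping one tuple still gives `2 ^ (n - 1)`, and `n ≤ 2 * (n - 1)`.
  have key : ∀ k : ℕ, A.card ≤ 2 * k → 2 ^ k * f ≤ (matchingRels n r m).card →
      (f : ℝ) ≤ (√2)⁻¹ ^ A.card * (matchingRels n r m).card := by
    intro k hk h
    have h' : (2 : ℝ) ^ k * f ≤ (matchingRels n r m).card := by exact_mod_cast h
    rw [inv_pow, ← div_eq_inv_mul, le_div_iff₀ (by positivity)]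
    refine le_trans ?_ h'
    rw [mul_comm]
    gcongr
    calc √2 ^ A.card ≤ √2 ^ (2 * k) :=
          pow_le_pow_right₀ (Real.one_le_sqrt.2 (by norm_num)) hk
      _ = 2 ^ k := by rw [pow_mul, Real.sq_sqrt (by norm_num)]
  by_cases hA : A.card + 1 ≤ n
  · exact key A.card (by omega) (matchingRels_superset_le hr A hA)
  by_cases hAn : A.card = n
  · obtain ⟨t, ht⟩ : A.Nonempty := Finset.card_pos.1 (by omega)
    have hc := Finset.card_erase_of_mem ht
    refine key (A.erase t).card (by omega) (le_trans ?_
      (matchingRels_superset_le (m := m) hr (A.erase t) (by omega)))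
    refine Nat.mul_le_mul_left _ (Finset.card_le_card fun S hS => ?_)
    rw [Finset.mem_filter] at hS ⊢
    exact ⟨hS.1, (Finset.erase_subset _ _).trans hS.2⟩
  · have : f = 0 := by
      rw [hf, Finset.card_eq_zero]
      refine Finset.filter_eq_empty_iff.2 fun S hS hAS => ?_
      have h1 := Finset.card_le_card hAS
      have h2 : S.card = m := (Finset.mem_filter.1 hS).2.1
      omega
    rw [this]
    simp only [Nat.cast_zero]
    positivity

lemma IsSpread.mono {n r : ℕ} {β β' : ℝ} {D : Finset (DBRel n r)} (h : IsSpread β D) (hβ : 0 ≤ β)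
    (hle : β ≤ β') : IsSpread β' D := fun A =>
  (h A).trans (by gcongr)

lemma sizeRels_nonempty {n r m : ℕ} (h : m ≤ n ^ r) : (sizeRels n r m).Nonempty := by
  obtain ⟨S, -, hS⟩ := Finset.exists_subset_card_eq
    (s := (Finset.univ : Finset (Fin r → Fin n))) (n := m) (by simpa using h)
  exact ⟨S, by simp [sizeRels, hS]⟩

lemma matchingRels_nonempty {n r m : ℕ} (hr : 0 < r) (h : m ≤ n) :
    (matchingRels n r m).Nonempty := by
  classical
  have hinj : Function.Injective fun (v : Fin n) (_ : Fin r) => v :=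
    fun v w hvw => congrFun hvw ⟨0, hr⟩
  obtain ⟨T, -, hT⟩ := Finset.exists_subset_card_eq
    (s := (Finset.univ : Finset (Fin n))) (n := m) (by simpa using h)
  refine ⟨T.map ⟨_, hinj⟩, ?_⟩
  simp only [matchingRels, Finset.mem_filter, Finset.mem_univ, true_and, Finset.card_map, hT,
    Finset.mem_map, Function.Embedding.coeFn_mk]
  rintro i _ ⟨v, _, rfl⟩ _ ⟨w, _, rfl⟩ hvw
  have : v = w := hvw
  rw [this]

/-! ### A Hölder inequality for functions of overlapping sets of variables -/

-- Hölder, with the missing weight `1 - ∑ u j` placed on the constant function 1, whose integral is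
-- 1.
open MeasureTheory in
lemma lintegral_prod_rpow_le_of_sum_le_one {α κ : Type*} [MeasurableSpace α] {μ : Measure α}
    [IsProbabilityMeasure μ] (s : Finset κ) {f : κ → α → ℝ≥0∞} (hf : ∀ j, Measurable (f j))
    {u : κ → ℝ} (hu₀ : ∀ j, 0 ≤ u j) (hu : ∑ j ∈ s, u j ≤ 1) :
    ∫⁻ a, ∏ j ∈ s, f j a ^ u j ∂μ ≤ ∏ j ∈ s, (∫⁻ a, f j a ∂μ) ^ u j := by
  have h := ENNReal.lintegral_mul_prod_norm_pow_le (μ := μ) s (g := fun _ => 1) (f := f)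
    aemeasurable_const (fun j _ => (hf j).aemeasurable) (1 - ∑ j ∈ s, u j) (p := u) (by ring)
    (by linarith) (fun j _ => hu₀ j)
  simpa using h

-- Variables are integrated out one at a time. Factors independent of the current variable leave the
-- integral; the others have total exponent at most 1, so Hölder applies to them.
open MeasureTheory in
lemma lmarginal_prod_rpow_le {ι κ : Type*} [Fintype ι] [DecidableEq ι] [Fintype κ]
    {X : ι → Type*} [∀ i, MeasurableSpace (X i)] (μ : ∀ i, Measure (X i))
    [∀ i, IsProbabilityMeasure (μ i)] (V : κ → Set ι) {F : κ → (∀ i, X i) → ℝ≥0∞}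
    (hF : ∀ j, Measurable (F j)) (hV : ∀ j, DependsOn (F j) (V j)) {u : κ → ℝ}
    (hu₀ : ∀ j, 0 ≤ u j) (hu : ∀ i, ∀ s : Finset κ, (∀ j ∈ s, i ∈ V j) → ∑ j ∈ s, u j ≤ 1)
    (s : Finset ι) (x : ∀ i, X i) :
    lmarginal μ s (fun x => ∏ j, F j x ^ u j) x ≤ ∏ j, lmarginal μ s (F j) x ^ u j := by
  classical
  induction s using Finset.induction_on generalizing x with
  | empty => simp
  | insert i s hi ih =>
    have hconst : ∀ j, i ∉ V j → ∀ y, lmarginal μ s (F j) (Function.update x i y) =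
        lmarginal μ s (F j) x := by
      intro j hj y
      rw [lmarginal_update_of_notMem (hF j) hi]
      congr 1
      funext z
      refine hV j fun i' hi' => Function.update_of_ne ?_ _ _
      rintro rfl
      exact hj hi'
    have hmeas : ∀ j, Measurable fun y => lmarginal μ s (F j) (Function.update x i y) :=
      fun j => ((hF j).lmarginal μ).comp (measurable_update x)
    rw [lmarginal_insert _ (Finset.measurable_prod _ fun j _ => (hF j).pow_const _) hi]
    have hR : ∀ j, lmarginal μ (insert i s) (F j) x =
        ∫⁻ y, lmarginal μ s (F j) (Function.update x i y) ∂μ i :=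
      fun j => lmarginal_insert _ (hF j) hi x
    calc _ ≤ ∫⁻ y, ∏ j, lmarginal μ s (F j) (Function.update x i y) ^ u j ∂μ i :=
          lintegral_mono fun y => ih _
      _ = ∫⁻ y, (∏ j with i ∈ V j, lmarginal μ s (F j) (Function.update x i y) ^ u j) *
            ∏ j with i ∉ V j, lmarginal μ s (F j) x ^ u j ∂μ i := by
          refine lintegral_congr fun y => ?_
          rw [← Finset.prod_filter_mul_prod_filter_not Finset.univ (fun j => i ∈ V j)]
          congr 1
          refine Finset.prod_congr rfl fun j hj => ?_
          rw [hconst j (Finset.mem_filter.1 hj).2]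
      _ = (∫⁻ y, ∏ j with i ∈ V j, lmarginal μ s (F j) (Function.update x i y) ^ u j ∂μ i) *
            ∏ j with i ∉ V j, lmarginal μ s (F j) x ^ u j :=
          lintegral_mul_const _ (Finset.measurable_prod _ fun j _ => (hmeas j).pow_const _)
      _ ≤ (∏ j with i ∈ V j, lmarginal μ (insert i s) (F j) x ^ u j) *
            ∏ j with i ∉ V j, lmarginal μ (insert i s) (F j) x ^ u j := by
          refine mul_le_mul' ?_ (le_of_eq ?_)
          · simp_rw [hR]
            exact lintegral_prod_rpow_le_of_sum_le_one _ hmeas hu₀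
              (hu i _ fun j hj => (Finset.mem_filter.1 hj).2)
          · refine Finset.prod_congr rfl fun j hj => ?_
            simp_rw [hR, hconst j (Finset.mem_filter.1 hj).2]
            simp
      _ = _ := Finset.prod_filter_mul_prod_filter_not _ _ _

/-- The sum over all assignments of a function of the distinct coordinates `e`. -/
lemma sum_comp_embedding {k r n : ℕ} [NeZero n] (e : Fin r ↪ Fin k)
    (h : (Fin r → Fin n) → ℝ≥0∞) :
    (n : ℝ≥0∞) ^ r * ∑ x : Fin k → Fin n, h (fun i => x (e i)) = (n : ℝ≥0∞) ^ k * ∑ t, h t := by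
  have h1 : ∑ s : Fin r → Fin n, ∑ x : Fin k → Fin n, h ((fun i => x (e i)) + s) =
      (n : ℝ≥0∞) ^ r * ∑ x : Fin k → Fin n, h (fun i => x (e i)) := by
    rw [Finset.sum_congr rfl (g := fun _ => ∑ x : Fin k → Fin n, h (fun i => x (e i)))]
    · simp
    · intro s _
      -- Translating `x` by `s` on the coordinates in the range of `e`, with addition modulo `n`,
      -- permutes the assignments.
      rw [← Equiv.sum_comp (Equiv.addRight (Function.extend e s 0))
        (fun x : Fin k → Fin n => h (fun i => x (e i)))]
      refine Finset.sum_congr rfl fun x _ => congrArg h ?_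
      funext i
      simp [e.injective.extend_apply]
  rw [← h1, Finset.sum_comm, Finset.sum_congr rfl (g := fun _ => ∑ t, h t)]
  · simp
  · intro x _
    exact Equiv.sum_comp (Equiv.addLeft fun i => x (e i)) h

/-- For weights `f j` with values in `[0, 1]`, the average over all assignments of their product is
bounded by the weighted geometric mean of their averages. -/
lemma FullCQ.sum_prod_le (q : FullCQ) {n : ℕ} (hn : n ≠ 0) {u : Fin q.l → ℝ}
    (hu : q.IsEdgePacking u) (f : ∀ j, (Fin (q.arity j) → Fin n) → ℝ≥0∞) (hf : ∀ j t, f j t ≤ 1) :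
    (∑ x : Fin q.k → Fin n, ∏ j, f j (fun i => x (q.vars j i))) / (n : ℝ≥0∞) ^ q.k ≤
      ∏ j, ((∑ t, f j t) / (n : ℝ≥0∞) ^ q.arity j) ^ u j := by
  classical
  have : NeZero n := ⟨hn⟩
  have hn0 : (n : ℝ≥0∞) ≠ 0 := by simpa using hn
  have hnt : (n : ℝ≥0∞) ≠ ∞ := by simp
  let P : MeasureTheory.Measure (Fin n) := (n : ℝ≥0∞)⁻¹ • MeasureTheory.Measure.count
  have : MeasureTheory.IsProbabilityMeasure P := ⟨by
    simp [P, MeasureTheory.Measure.count_apply, ENNReal.inv_mul_cancel hn0 hnt]⟩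
  have hint : ∀ h : (Fin q.k → Fin n) → ℝ≥0∞,
      ∫⁻ x, h x ∂(MeasureTheory.Measure.pi fun _ => P) = (∑ x, h x) / (n : ℝ≥0∞) ^ q.k := by
    intro h
    rw [MeasureTheory.lintegral_fintype, div_eq_mul_inv, Finset.sum_mul]
    refine Finset.sum_congr rfl fun x _ => ?_
    rw [MeasureTheory.Measure.pi_singleton]
    simp [P, ENNReal.inv_pow]
  -- Every atom has a variable, whose packing constraint bounds `u j`. With `f j ≤ 1` this gives `f
  -- j ≤ f j ^ u j`.
  have hle1 : ∀ j, u j ≤ 1 := by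
    intro j
    refine le_trans ?_ (hu.2 (q.vars j ⟨0, q.arity_pos j⟩))
    exact Finset.single_le_sum (f := u) (fun j _ => hu.1 j) (by simp)
  let F : Fin q.l → (Fin q.k → Fin n) → ℝ≥0∞ := fun j x => f j fun i => x (q.vars j i)
  have key := lmarginal_prod_rpow_le (fun _ : Fin q.k => P) (fun j => Set.range (q.vars j))
    (F := F) (fun j => Measurable.of_discrete)
    (fun j x y hxy => congrArg (f j) (funext fun i => hxy _ ⟨i, rfl⟩)) hu.1
    (fun i s hs => le_trans (Finset.sum_le_sum_of_subset_of_nonneg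
      (fun j hj => by simpa using hs j hj) fun j _ _ => hu.1 j) (hu.2 i)) Finset.univ
      (fun _ => 0)
  simp only [MeasureTheory.lmarginal_univ, hint] at key
  have hav : ∀ j, (∑ x, F j x) / (n : ℝ≥0∞) ^ q.k = (∑ t, f j t) / (n : ℝ≥0∞) ^ q.arity j := by
    intro j
    rw [ENNReal.div_eq_div_iff (pow_ne_zero _ hn0) (ENNReal.pow_ne_top hnt)
      (pow_ne_zero _ hn0) (ENNReal.pow_ne_top hnt)]
    exact sum_comp_embedding (q.vars j) (f j)
  simp only [hav] at key
  refine le_trans ?_ key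
  gcongr with x _ j _
  calc F j x = F j x ^ (1 : ℝ) := (ENNReal.rpow_one _).symm
    _ ≤ F j x ^ u j := ENNReal.rpow_le_rpow_of_exponent_ge (hf j _) (hle1 j)

/-! ### Outputs of one-round algorithms -/

lemma ENNReal.prod_rpow_eq_rpow_sum {κ : Type*} (s : Finset κ) (y : ℝ≥0∞) {u : κ → ℝ}
    (hu : ∀ j, 0 ≤ u j) : ∏ j ∈ s, y ^ u j = y ^ ∑ j ∈ s, u j := by
  classical
  induction s using Finset.induction_on with
  | empty => simp
  | insert j s hj ih =>
    rw [Finset.prod_insert hj, Finset.sum_insert hj, ih,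
      ENNReal.rpow_add_of_nonneg _ _ (hu j) (Finset.sum_nonneg fun j _ => hu j)]

/-- Independence of the atoms in counting form: for fixed `x`, the conditions on the relations
factor over the product class. -/
lemma sum_card_filter_forall_mem (q : FullCQ) {n : ℕ}
    (D : ∀ j : Fin q.l, Finset (DBRel n (q.arity j)))
    (K : ∀ j, DBRel n (q.arity j) → DBRel n (q.arity j)) :
    ∑ I ∈ Fintype.piFinset D,
      (Finset.univ.filter fun x : Fin q.k → Fin n =>
        ∀ j, (fun i => x (q.vars j i)) ∈ K j (I j)).card =
    ∑ x : Fin q.k → Fin n, ∏ j,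
      ((D j).filter fun S => (fun i => x (q.vars j i)) ∈ K j S).card := by
  classical
  have h := Finset.sum_card_bipartiteAbove_eq_sum_card_bipartiteBelow
    (s := (Finset.univ : Finset (Fin q.k → Fin n))) (t := Fintype.piFinset D)
    (fun x I => ∀ j, (fun i => x (q.vars j i)) ∈ K j (I j))
  simp only [Finset.bipartiteAbove, Finset.bipartiteBelow] at h
  rw [← h]
  refine Finset.sum_congr rfl fun x _ => ?_
  rw [← Fintype.card_piFinset]
  congr 1
  ext I
  simp only [Finset.mem_filter, Fintype.mem_piFinset]
  exact forall_and.symm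

lemma sum_card_filter_mem_known {n r : ℕ} (D : Finset (DBRel n r))
    (K : DBRel n r → DBRel n r) :
    ∑ t : Fin r → Fin n, (D.filter fun S => t ∈ K S).card = ∑ S ∈ D, (K S).card := by
  classical
  have h := Finset.sum_card_bipartiteAbove_eq_sum_card_bipartiteBelow
    (s := (Finset.univ : Finset (Fin r → Fin n))) (t := D) (fun t S => t ∈ K S)
  simp only [Finset.bipartiteAbove, Finset.bipartiteBelow] at h
  rw [h]
  simp

namespace OneRoundAlgorithm

variable {q : FullCQ} {n p : ℕ}

/-- A sound machine outputs only tuples all of whose projections are known to it. -/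
lemma IsSound.mem_knownTuples {A : OneRoundAlgorithm q n p}
    {D : ∀ j : Fin q.l, Finset (DBRel n (q.arity j))} (hA : A.IsSound (Fintype.piFinset D))
    {I : q.Instance n} (hI : I ∈ Fintype.piFinset D) (c : Fin p) {x : Fin q.k → Fin n}
    (hx : x ∈ A.out c fun j => A.msg c j (I j)) (j : Fin q.l) :
    (fun i => x (q.vars j i)) ∈ knownTuples (D j) (A.msg c j) (I j) := by
  classical
  simp only [knownTuples, Finset.mem_filter, Finset.mem_univ, true_and]
  intro S hS hmsg
  rw [Fintype.mem_piFinset] at hI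
  -- Replacing one relation by another with the same message stays in the support and leaves the
  -- machine's view unchanged.
  have hI' : Function.update I j S ∈ Fintype.piFinset D := by
    rw [Fintype.mem_piFinset]
    intro j'
    by_cases h : j' = j
    · subst h; simpa using hS
    · simpa [h] using hI j'
  have hsame : (fun j' => A.msg c j' (Function.update I j S j')) = fun j' => A.msg c j' (I j') := by
    funext j'
    by_cases h : j' = j
    · subst h; simpa using hmsg
    · simp [h]
  have hmem : x ∈ A.output (Function.update I j S) :=
    Finset.mem_biUnion.2 ⟨c, Finset.mem_univ _, by rw [hsame]; exact hx⟩
  have := (Finset.mem_filter.1 (hA _ hI' hmem)).2 j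
  simpa using this

/-- The expected number of answers is at most the expected number of tuples that are known to
some machine, both expectations being multiplied by the number of instances. -/
lemma sum_prod_card_le (A : OneRoundAlgorithm q n p)
    {D : ∀ j : Fin q.l, Finset (DBRel n (q.arity j))} (hD : ∀ j, (D j).Nonempty)
    (hA : A.IsSound (Fintype.piFinset D)) (hE : A.OutputsEnough (Fintype.piFinset D)) :
    ∑ x : Fin q.k → Fin n, ∏ j, ((D j).filter fun S => (fun i => x (q.vars j i)) ∈ S).card ≤
      ∑ c, ∑ x : Fin q.k → Fin n, ∏ j, ((D j).filter fun S =>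
        (fun i => x (q.vars j i)) ∈ knownTuples (D j) (A.msg c j) S).card := by
  classical
  have hne : (Fintype.piFinset D).Nonempty := Fintype.piFinset_nonempty.2 hD
  have hpos : (0 : ℝ) < (Fintype.piFinset D).card := by exact_mod_cast hne.card_pos
  have h1 : ∑ I ∈ Fintype.piFinset D, (q.eval I).card ≤
      ∑ I ∈ Fintype.piFinset D, (A.output I).card := by
    unfold OutputsEnough at hE
    rw [Finset.expect_eq_sum_div_card, Finset.expect_eq_sum_div_card,
      div_le_div_iff_of_pos_right hpos] at hE
    exact_mod_cast hE
  have h2 := sum_card_filter_forall_mem q D (fun _ S => S)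
  have h3 : ∀ c, _ := fun c =>
    sum_card_filter_forall_mem q D (fun j S => knownTuples (D j) (A.msg c j) S)
  rw [← h2, Finset.sum_congr rfl fun c _ => (h3 c).symm, Finset.sum_comm]
  refine h1.trans (Finset.sum_le_sum fun I hI => ?_)
  refine Finset.card_biUnion_le.trans (Finset.sum_le_sum fun c _ => Finset.card_le_card ?_)
  intro x hx
  exact Finset.mem_filter.2 ⟨Finset.mem_univ _, fun j => hA.mem_knownTuples hI c hx j⟩

lemma length_msg_le_sup_bits (A : OneRoundAlgorithm q n p)
    {D : ∀ j : Fin q.l, Finset (DBRel n (q.arity j))} (hD : ∀ j, (D j).Nonempty) (c : Fin p)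
    (j : Fin q.l) {S : DBRel n (q.arity j)} (hS : S ∈ D j) :
    (A.msg c j S).length ≤ (Fintype.piFinset D).sup (A.bits c) := by
  classical
  choose I hI using hD
  have hI' : Function.update I j S ∈ Fintype.piFinset D := by
    rw [Fintype.mem_piFinset]
    intro j'
    by_cases h : j' = j
    · subst h; simpa using hS
    · simpa [h] using hI j'
  refine le_trans ?_ (Finset.le_sup hI')
  have := Finset.single_le_sum (s := Finset.univ)
    (f := fun j' => (A.msg c j' (Function.update I j S j')).length) (fun _ _ => Nat.zero_le _)
    (Finset.mem_univ j)
  simpa [bits] using this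

/-- The bits received by the machines of an algorithm that finds all answers. -/
theorem rpow_le_sum_rpow (A : OneRoundAlgorithm q n p)
    {D : ∀ j : Fin q.l, Finset (DBRel n (q.arity j))} (hD : ∀ j, (D j).Nonempty)
    {m : ℕ} (hm : 0 < m) (hn : 0 < n) (hcard : ∀ j, ∀ S ∈ D j, S.card = m)
    (hinv : ∀ j, IsRenameInvariant (D j)) {β : ℝ} (hβ₀ : 0 < β) (hβ₁ : β < 1)
    (hspread : ∀ j, IsSpread β (D j)) {Λ : ℕ} (hΛ : Real.log 4 / Real.log β⁻¹ ≤ Λ)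
    {u : Fin q.l → ℝ} (hu : q.IsEdgePacking u)
    (hA : A.IsSound (Fintype.piFinset D)) (hE : A.OutputsEnough (Fintype.piFinset D)) :
    (m : ℝ≥0∞) ^ (∑ j, u j) ≤
      ∑ c, ((Λ * (Fintype.piFinset D).sup (A.bits c) : ℕ) : ℝ≥0∞) ^ (∑ j, u j) := by
  classical
  set X : Fin p → ℕ := fun c => (Fintype.piFinset D).sup (A.bits c) with hX
  have hm0 : (m : ℝ≥0∞) ≠ 0 := by simpa using hm.ne'
  have hn0 : (n : ℝ≥0∞) ≠ 0 := by simpa using hn.ne'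
  -- the number of relations that contain, or are known to contain, a given tuple
  let N : ∀ j, (Fin (q.arity j) → Fin n) → ℕ := fun j t => ((D j).filter fun S => t ∈ S).card
  let k : Fin p → ∀ j, (Fin (q.arity j) → Fin n) → ℕ := fun c j t =>
    ((D j).filter fun S => t ∈ knownTuples (D j) (A.msg c j) S).card
  have hN : ∀ j t, N j t * n ^ q.arity j = m * (D j).card := fun j t =>
    card_filter_mem (hinv j) (hcard j) t
  let N' : Fin q.l → ℕ := fun j => N j fun _ => ⟨0, hn⟩
  have hNN' : ∀ j t, N j t = N' j := fun j t =>
    Nat.eq_of_mul_eq_mul_right (pow_pos hn _) ((hN j t).trans (hN j _).symm)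
  have hN'pos : ∀ j, 0 < N' j := by
    intro j
    refine Nat.pos_of_ne_zero fun h => ?_
    have := hN j fun _ => ⟨0, hn⟩
    have h' : N j (fun _ => ⟨0, hn⟩) = 0 := h
    rw [h', zero_mul] at this
    exact (Nat.mul_pos hm (hD j).card_pos).ne this
  have hN'0 : ∀ j, (N' j : ℝ≥0∞) ≠ 0 := fun j => by simpa using (hN'pos j).ne'
  have hkN : ∀ c j t, k c j t ≤ N' j := by
    intro c j t
    rw [← hNN' j t]
    refine Finset.card_le_card fun S hS => ?_
    rw [Finset.mem_filter] at hS ⊢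
    exact ⟨hS.1, (Finset.mem_filter.1 hS.2).2 S hS.1 rfl⟩
  have hkey : n ^ q.k * ∏ j, N' j ≤
      ∑ c, ∑ x : Fin q.k → Fin n, ∏ j, k c j (fun i => x (q.vars j i)) := by
    refine le_trans (le_of_eq ?_) (A.sum_prod_card_le hD hA hE)
    rw [Finset.sum_congr rfl (g := fun _ => ∏ j, N' j)]
    · simp
    · intro x _
      exact Finset.prod_congr rfl fun j _ => hNN' j _
  have hsumk : ∀ c j, ∑ t, k c j t ≤ Λ * X c * (D j).card := by
    intro c j
    have h1 := sum_card_knownTuples_le hβ₀ hβ₁ (hspread j) (A.msg c j)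
      fun S hS => A.length_msg_le_sup_bits hD c j hS
    have h2 : ∑ S ∈ D j, ((knownTuples (D j) (A.msg c j) S).card : ℝ) ≤
        Λ * (X c : ℝ) * (D j).card := h1.trans (by gcongr)
    rw [show ∑ t, k c j t = ∑ S ∈ D j, (knownTuples (D j) (A.msg c j) S).card from
      sum_card_filter_mem_known (D j) (knownTuples (D j) (A.msg c j))]
    exact_mod_cast h2
  -- The quotient `k c j t / N' j` is the conditional probability that `t` is known, given that it
  -- belongs to the relation.
  have hmachine : ∀ c, (∑ x : Fin q.k → Fin n, ∏ j,
      ((k c j (fun i => x (q.vars j i)) : ℝ≥0∞) / N' j)) / (n : ℝ≥0∞) ^ q.k ≤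
        (((Λ * X c : ℕ) : ℝ≥0∞) / m) ^ ∑ j, u j := by
    intro c
    refine (q.sum_prod_le hn.ne' hu (fun j t => (k c j t : ℝ≥0∞) / N' j) fun j t => ?_).trans ?_
    · exact ENNReal.div_le_of_le_mul (by rw [one_mul]; exact_mod_cast hkN c j t)
    · rw [← ENNReal.prod_rpow_eq_rpow_sum _ _ hu.1]
      refine Finset.prod_le_prod' fun j _ => ENNReal.rpow_le_rpow ?_ (hu.1 j)
      have hd0 : ((D j).card : ℝ≥0∞) ≠ 0 := by simpa using (hD j).ne_empty
      have e1 : (∑ t, (k c j t : ℝ≥0∞) / N' j) / (n : ℝ≥0∞) ^ q.arity j =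
          ((∑ t, k c j t : ℕ) : ℝ≥0∞) / ((m * (D j).card : ℕ) : ℝ≥0∞) := by
        rw [← hN j (fun _ => ⟨0, hn⟩)]
        simp only [div_eq_mul_inv]
        rw [← Finset.sum_mul, mul_assoc, ← ENNReal.mul_inv (Or.inl (hN'0 j)) (Or.inl (by simp))]
        push_cast
        rfl
      rw [e1]
      calc _ ≤ ((Λ * X c * (D j).card : ℕ) : ℝ≥0∞) / ((m * (D j).card : ℕ) : ℝ≥0∞) := by
            gcongr
            exact_mod_cast hsumk c j
        _ = _ := by
            push_cast
            rw [ENNReal.mul_div_mul_right _ _ hd0 (by simp)]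
  have hone : (1 : ℝ≥0∞) ≤ ∑ c, (((Λ * X c : ℕ) : ℝ≥0∞) / m) ^ ∑ j, u j := by
    refine le_trans ?_ (Finset.sum_le_sum fun c _ => hmachine c)
    have hP0 : (∏ j, (N' j : ℝ≥0∞)) ≠ 0 := Finset.prod_ne_zero_iff.2 fun j _ => hN'0 j
    have hPt : (∏ j, (N' j : ℝ≥0∞)) ≠ ∞ := ENNReal.prod_ne_top fun j _ => by simp
    have e2 : ∀ c, (∑ x : Fin q.k → Fin n, ∏ j,
        ((k c j (fun i => x (q.vars j i)) : ℝ≥0∞) / N' j)) / (n : ℝ≥0∞) ^ q.k =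
        ((∑ x : Fin q.k → Fin n, ∏ j, k c j (fun i => x (q.vars j i)) : ℕ) : ℝ≥0∞) /
          ((n : ℝ≥0∞) ^ q.k * ∏ j, (N' j : ℝ≥0∞)) := by
      intro c
      simp only [div_eq_mul_inv, Finset.prod_mul_distrib]
      rw [← Finset.sum_mul, mul_assoc, ENNReal.mul_inv (Or.inl (pow_ne_zero _ hn0))
        (Or.inl (ENNReal.pow_ne_top (by simp))), mul_comm ((n : ℝ≥0∞) ^ q.k)⁻¹,
        ENNReal.prod_inv_distrib]
      · push_cast
        rfl
      · intro i _ j _ _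
        exact Or.inl (hN'0 i)
    simp only [e2]
    simp only [div_eq_mul_inv]
    rw [← Finset.sum_mul, ← div_eq_mul_inv, ENNReal.le_div_iff_mul_le
      (Or.inl (mul_ne_zero (pow_ne_zero _ hn0) hP0))
      (Or.inl (ENNReal.mul_ne_top (ENNReal.pow_ne_top (by simp)) hPt)), one_mul]
    exact_mod_cast hkey
  have hU : 0 ≤ ∑ j, u j := Finset.sum_nonneg fun j _ => hu.1 j
  simp only [ENNReal.div_rpow_of_nonneg _ _ hU] at hone
  simp only [div_eq_mul_inv] at hone
  rw [← Finset.sum_mul, ← div_eq_mul_inv, ENNReal.le_div_iff_mul_le, one_mul] at hone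
  · exact hone
  · left
    simp [ENNReal.rpow_eq_zero_iff, hm0]
  · left
    exact ENNReal.rpow_ne_top_of_nonneg hU (by simp)

end OneRoundAlgorithm

/-! ### Cost functions and the optimal load -/

lemma le_gStar {g : ℕ → ℝ≥0} {L : ℝ≥0} {x : ℕ} (h : g x ≤ L) : (x : ℕ∞) ≤ gStar g L :=
  le_iSup₂_of_le x h le_rfl

lemma gStar_mono (g : ℕ → ℝ≥0) : Monotone (gStar g) := fun _ _ h =>
  iSup₂_le fun _ hx => le_gStar (hx.trans h)

lemma IsWellBehaved.le_of_mul {a : ℝ} {g : ℕ → ℝ≥0} (hg : IsWellBehaved a g) {Λ : ℕ} (hΛ : 1 ≤ Λ)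
    (x : ℕ) : g (Λ * x) ≤ (Λ : ℝ≥0) ^ a * g x := by
  rcases Nat.eq_zero_or_pos x with rfl | hx
  · simp [hg.map_zero]
  have h := hg.growth x (Λ * x) (Λ - 1) hx (by simpa using hΛ) (by push_cast; ring)
  rw [← NNReal.coe_le_coe]
  push_cast
  simpa using h

lemma feasibleLoads_nonempty {p : ℕ} (hp : 1 ≤ p) (g : Fin p → ℕ → ℝ≥0) (m : ℕ) {u : ℝ}
    (hu : 0 ≤ u) : (feasibleLoads g m u).Nonempty := by
  let c : Fin p := ⟨0, hp⟩
  refine ⟨g c m, ?_⟩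
  refine le_trans ?_ (Finset.single_le_sum (f := fun c' => (gStar (g c') (g c m) : ℝ≥0∞) ^ u)
    (fun _ _ => zero_le) (Finset.mem_univ c))
  refine ENNReal.rpow_le_rpow ?_ hu
  exact_mod_cast le_gStar (le_refl (g c m))

/-- `gStar g` is constant on a right neighbourhood of every load. -/
lemma exists_gStar_eq {g : ℕ → ℝ≥0} (hg : Monotone g) (L : ℝ≥0) :
    ∃ L', L < L' ∧ gStar g L' = gStar g L := by
  by_cases h : ∀ x, g x ≤ L
  · refine ⟨L + 1, lt_add_one L, le_antisymm ?_ (gStar_mono g (by simp))⟩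
    exact iSup₂_le fun x _ => le_gStar (h x)
  · push Not at h
    obtain ⟨y, hy⟩ := h
    classical
    have hex : ∃ x, L < g x := ⟨y, hy⟩
    have hx := Nat.find_spec hex
    obtain ⟨L', h1, h2⟩ := exists_between hx
    refine ⟨L', h1, le_antisymm ?_ (gStar_mono g h1.le)⟩
    refine iSup₂_le fun x hxL => le_gStar ?_
    have hlt : x < Nat.find hex := by
      by_contra hle
      exact absurd ((h2.trans_le (hg (not_lt.1 hle))).trans_le hxL) (lt_irrefl _)
    exact not_lt.1 (Nat.find_min hex hlt)

/-- Since there are finitely many machines, one right neighbourhood of the infimum has all `gStar`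
values constant. It contains a feasible load, so the infimum is feasible as well. -/
lemma isLeast_lowerLoad {p : ℕ} (hp : 1 ≤ p) {g : Fin p → ℕ → ℝ≥0} (hg : ∀ c, Monotone (g c))
    (m : ℕ) {u : ℝ} (hu : 0 ≤ u) : IsLeast (feasibleLoads g m u) (lowerLoad g m u) := by
  refine ⟨?_, fun L hL => csInf_le' hL⟩
  choose L' hL' hL'eq using fun c => exists_gStar_eq (hg c) (lowerLoad g m u)
  have hne : (Finset.univ : Finset (Fin p)).Nonempty := ⟨⟨0, hp⟩, Finset.mem_univ _⟩
  have hlt : lowerLoad g m u < Finset.univ.inf' hne L' := by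
    rw [Finset.lt_inf'_iff]
    exact fun c _ => hL' c
  obtain ⟨L, hL, hLlt⟩ := exists_lt_of_csInf_lt (feasibleLoads_nonempty hp g m hu) hlt
  have hle : lowerLoad g m u ≤ L := csInf_le' hL
  refine le_trans hL (Finset.sum_le_sum fun c _ => ENNReal.rpow_le_rpow ?_ hu)
  have : gStar (g c) L ≤ gStar (g c) (lowerLoad g m u) := by
    rw [← hL'eq c]
    exact gStar_mono (g c) (hLlt.le.trans (Finset.inf'_le _ (Finset.mem_univ c)))
  exact_mod_cast this

/-- If some `gStar (g c) L` reaches `m`, that term suffices for any exponent. Otherwise all ratios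
to `m` are below 1, and lowering the exponent increases their powers. -/
lemma feasibleLoads_anti {p : ℕ} (hp : 1 ≤ p) (g : Fin p → ℕ → ℝ≥0) (m : ℕ) {u u' : ℝ}
    (hu' : 0 ≤ u') (h : u' ≤ u) : feasibleLoads g m u ⊆ feasibleLoads g m u' := by
  intro L hL
  change (m : ℝ≥0∞) ^ u' ≤ ∑ c, (gStar (g c) L : ℝ≥0∞) ^ u'
  have hL : (m : ℝ≥0∞) ^ u ≤ ∑ c, (gStar (g c) L : ℝ≥0∞) ^ u := hL
  by_cases hbig : ∃ c, (m : ℝ≥0∞) ≤ (gStar (g c) L : ℝ≥0∞)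
  · obtain ⟨c, hc⟩ := hbig
    exact (ENNReal.rpow_le_rpow hc hu').trans
      (Finset.single_le_sum (f := fun c => (gStar (g c) L : ℝ≥0∞) ^ u') (fun _ _ => zero_le)
        (Finset.mem_univ c))
  push Not at hbig
  have hm0 : (m : ℝ≥0∞) ≠ 0 := zero_le.trans_lt (hbig ⟨0, hp⟩) |>.ne'
  have hmt : (m : ℝ≥0∞) ≠ ∞ := by simp
  have key : ∀ c, (m : ℝ≥0∞) ^ (u - u') * (gStar (g c) L : ℝ≥0∞) ^ u' ≥
      (gStar (g c) L : ℝ≥0∞) ^ u := by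
    intro c
    calc (gStar (g c) L : ℝ≥0∞) ^ u
        = (gStar (g c) L : ℝ≥0∞) ^ (u - u') * (gStar (g c) L : ℝ≥0∞) ^ u' := by
          rw [← ENNReal.rpow_add_of_nonneg _ _ (by linarith) hu', sub_add_cancel]
      _ ≤ _ := by
          gcongr
          exact (hbig c).le
  have h1 : (m : ℝ≥0∞) ^ (u - u') * (m : ℝ≥0∞) ^ u' ≤
      (m : ℝ≥0∞) ^ (u - u') * ∑ c, (gStar (g c) L : ℝ≥0∞) ^ u' := by
    rw [← ENNReal.rpow_add_of_nonneg _ _ (by linarith) hu', sub_add_cancel, Finset.mul_sum]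
    exact hL.trans (Finset.sum_le_sum fun c _ => key c)
  refine (ENNReal.mul_le_mul_iff_right ?_ ?_).1 h1
  · simp [ENNReal.rpow_eq_zero_iff, hm0]
  · exact ENNReal.rpow_ne_top_of_nonneg (by linarith) hmt

lemma lowerLoad_mono {p : ℕ} (hp : 1 ≤ p) (g : Fin p → ℕ → ℝ≥0) (m : ℕ) {u u' : ℝ}
    (hu' : 0 ≤ u') (h : u' ≤ u) : lowerLoad g m u' ≤ lowerLoad g m u :=
  csInf_le_csInf' (feasibleLoads_nonempty hp g m (hu'.trans h)) (feasibleLoads_anti hp g m hu' h)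

lemma lowerLoad_zero {p : ℕ} (hp : 1 ≤ p) (g : Fin p → ℕ → ℝ≥0) {u : ℝ} (hu : 0 ≤ u) :
    lowerLoad g 0 u = 0 := by
  refine le_antisymm (csInf_le' ?_) zero_le
  -- One machine is needed even for `m = 0`: if `u = 0`, the left side is `0 ^ 0 = 1`.
  refine le_trans ?_ (Finset.single_le_sum (f := fun c => (gStar (g c) 0 : ℝ≥0∞) ^ u)
    (fun _ _ => zero_le) (Finset.mem_univ ⟨0, hp⟩))
  exact ENNReal.rpow_le_rpow (by simp) hu

/-- The load of an algorithm that finds all answers over a spread class of databases. -/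
theorem OneRoundAlgorithm.lowerLoad_le {q : FullCQ} {n p : ℕ} (A : OneRoundAlgorithm q n p)
    (hp : 1 ≤ p) {D : ∀ j : Fin q.l, Finset (DBRel n (q.arity j))} (hD : ∀ j, (D j).Nonempty)
    {m : ℕ} (hn : 0 < n) (hcard : ∀ j, ∀ S ∈ D j, S.card = m)
    (hinv : ∀ j, IsRenameInvariant (D j)) {β : ℝ} (hβ₀ : 0 < β) (hβ₁ : β < 1)
    (hspread : ∀ j, IsSpread β (D j)) {Λ : ℕ} (hΛ₁ : 1 ≤ Λ)
    (hΛ : Real.log 4 / Real.log β⁻¹ ≤ Λ) {u : Fin q.l → ℝ} (hu : q.IsEdgePacking u)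
    {a : ℝ} {g : Fin p → ℕ → ℝ≥0} (hg : ∀ c, IsWellBehaved a (g c))
    (hA : A.IsSound (Fintype.piFinset D)) (hE : A.OutputsEnough (Fintype.piFinset D)) :
    ((Λ : ℝ≥0) ^ a)⁻¹ * lowerLoad g m (∑ j, u j) ≤ A.load g (Fintype.piFinset D) := by
  have hU : 0 ≤ ∑ j, u j := Finset.sum_nonneg fun j _ => hu.1 j
  rcases Nat.eq_zero_or_pos m with rfl | hm
  · simp [lowerLoad_zero hp g hU]
  have hpos : 0 < (Λ : ℝ≥0) ^ a := NNReal.rpow_pos (by exact_mod_cast hΛ₁)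
  rw [inv_mul_le_iff₀ hpos]
  refine csInf_le' ?_
  refine (A.rpow_le_sum_rpow hD hm hn hcard hinv hβ₀ hβ₁ hspread hΛ hu hA hE).trans
    (Finset.sum_le_sum fun c _ => ENNReal.rpow_le_rpow ?_ hU)
  -- The maximal bit count of machine `c` is attained on a single instance, so its cost is already
  -- part of the load.
  have hmax : g c ((Fintype.piFinset D).sup (A.bits c)) ≤ A.load g (Fintype.piFinset D) := by
    obtain ⟨I, hI, hIeq⟩ := Finset.exists_mem_eq_sup _ (Fintype.piFinset_nonempty.2 hD) (A.bits c)
    rw [hIeq]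
    exact le_trans (Finset.le_sup (f := fun c => g c (A.bits c I)) (Finset.mem_univ c))
      (Finset.le_sup (f := fun I => Finset.univ.sup fun c => g c (A.bits c I)) hI)
  have h := le_gStar (((hg c).le_of_mul hΛ₁ ((Fintype.piFinset D).sup (A.bits c))).trans
    (mul_le_mul_right hmax ((Λ : ℝ≥0) ^ a)))
  exact_mod_cast h

theorem mainTheorem6 (q : FullCQ) (θ a : ℝ) (hθ₀ : 0 < θ) (hθ₁ : θ < 1) (ha : 1 < a) :
    -- the lower bound, with a constant depending only on `q`, `θ` and `a`
    (∃ C : ℝ≥0, 0 < C ∧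
      ∀ (n m p : ℕ) (_ : 2 ≤ n) (_ : 1 ≤ p)
        (g : Fin p → ℕ → ℝ≥0) (_ : ∀ c, IsWellBehaved a (g c))
        (u : Fin q.l → ℝ) (_ : q.IsEdgePacking u)
        (A : OneRoundAlgorithm q n p),
        -- matching databases
        ((m ≤ n ∧ ∀ j, q.arity j = 1 → (m : ℝ) ≤ θ * n) →
          A.IsSound (q.matchingDBs n m) → A.OutputsEnough (q.matchingDBs n m) →
          C * lowerLoad g m (∑ j, u j) ≤ A.load g (q.matchingDBs n m)) ∧
        -- `θ`-dense databases
        ((∀ j, (m : ℝ) = θ * (n : ℝ) ^ q.arity j) →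
          A.IsSound (q.denseDBs n m) → A.OutputsEnough (q.denseDBs n m) →
          C * lowerLoad g m (∑ j, u j) ≤ A.load g (q.denseDBs n m))) ∧
    ∀ (m p : ℕ) (_ : 1 ≤ p) (g : Fin p → ℕ → ℝ≥0) (_ : ∀ c, IsWellBehaved a (g c)),
      -- the minimum that defines the bound is attained
      (∀ u, q.IsEdgePacking u →
        IsLeast (feasibleLoads g m (∑ j, u j)) (lowerLoad g m (∑ j, u j))) ∧
      -- the maximum edge packing gives the best bound
      (∀ u, q.IsMaxEdgePacking u →
        IsGreatest {L | ∃ u', q.IsEdgePacking u' ∧ L = lowerLoad g m (∑ j, u' j)}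
          (lowerLoad g m (∑ j, u j))) := by
  have hsum : ∀ u, q.IsEdgePacking u → 0 ≤ ∑ j, u j := fun u hu =>
    Finset.sum_nonneg fun j _ => hu.1 j
  refine ⟨?_, fun m p hp g hg => ⟨fun u hu => isLeast_lowerLoad hp (fun c => (hg c).mono) m
    (hsum u hu), fun u hu => ⟨⟨u, hu.1, rfl⟩, ?_⟩⟩⟩
  · have hs0 : 0 < (√2)⁻¹ := by positivity
    have hs1 : (√2)⁻¹ < 1 := inv_lt_one_of_one_lt₀ (Real.lt_sqrt_of_sq_lt (by norm_num))
    -- One rate for all atoms: `θ` serves dense relations and unary matchings, `(√2)⁻¹` matchings of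
    -- larger arity.
    set β : ℝ := max θ (√2)⁻¹ with hβ
    have hβ₀ : 0 < β := lt_max_of_lt_left hθ₀
    have hβ₁ : β < 1 := max_lt hθ₁ hs1
    set Λ : ℕ := ⌈Real.log 4 / Real.log β⁻¹⌉₊ + 1 with hΛdef
    have hΛ : Real.log 4 / Real.log β⁻¹ ≤ Λ := by
      rw [hΛdef]
      push_cast
      exact (Nat.le_ceil _).trans (by simp)
    have hΛ₁ : 1 ≤ Λ := by omega
    refine ⟨((Λ : ℝ≥0) ^ a)⁻¹, inv_pos.2 (NNReal.rpow_pos (by exact_mod_cast hΛ₁)), ?_⟩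
    intro n m p hn hp g hg u hu A
    refine ⟨fun hm hA hE => ?_, fun hm hA hE => ?_⟩
    · refine A.lowerLoad_le hp (fun j => matchingRels_nonempty (q.arity_pos j) hm.1) (by omega)
        (fun j S hS => (Finset.mem_filter.1 hS).2.1)
        (fun j => isRenameInvariant_matchingRels _ _ _) hβ₀ hβ₁ (fun j => ?_) hΛ₁ hΛ hu hg hA hE
      by_cases hr : q.arity j = 1
      · have h := isSpread_sizeRels (n := n) (r := 1) (m := m) hθ₀.le hθ₁.le
          (by simpa using hm.2 j hr)
        rw [← matchingRels_one, ← hr] at h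
        exact h.mono hθ₀.le (le_max_left _ _)
      · have := q.arity_pos j
        exact (isSpread_matchingRels (by omega) hn hm.1).mono hs0.le (le_max_right _ _)
    · refine A.lowerLoad_le hp (fun j => sizeRels_nonempty ?_) (by omega)
        (fun j S hS => (Finset.mem_filter.1 hS).2)
        (fun j => isRenameInvariant_sizeRels _ _ _) hβ₀ hβ₁ (fun j => ?_) hΛ₁ hΛ hu hg hA hE
      · have h : (m : ℝ) ≤ (n : ℝ) ^ q.arity j := by
          rw [hm j]
          exact mul_le_of_le_one_left (by positivity) hθ₁.le
        exact_mod_cast h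
      · exact (isSpread_sizeRels hθ₀.le hθ₁.le (hm j).le).mono hθ₀.le (le_max_left _ _)
  · rintro L ⟨u', hu', rfl⟩
    exact lowerLoad_mono hp g m (hsum u' hu') (hu.2 u' hu')
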